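/- Let $\mathbb F=\mathbb R$ or $\mathbb C$, let $A\in\mathbb F^{n\times n}$ be Hermitian and invertible, let $\omega_{\min}:=-\lambda_{\min}(A)$ with $\lambda_{\min}(A)$ the smallest eigenvalue of $A$, and put $A_\omega:=A+\omega I$. Let $\mathcal S\subseteq\mathbb F^n$ be a subspace of dimension $p\ge 1$ and $q:=\dim(\mathcal S+A\mathcal S)-\dim\mathcal S$. Choose $V\in\mathbb F^{n\times p}$ and $V'\in\mathbb F^{n\times q}$ such that the columns of $\begin{bmatrix}V&V'\end{bmatrix}$ are orthonormal, $\operatorname{Im}V=\mathcal S$ and $\operatorname{Im}\begin{bmatrix}V&V'\end{bmatrix}=\mathcal S+A\mathcal S$. Set $$T:=V^*AV,\quad B:=V'^*AV,\quad H:=\begin{bmatrix}T\\B\end{bmatrix},\quad \mathcal Y:=\operatorname{Im}\bigl(V(H^*H)^{-1}B^*\bigr)$$ (so $\mathcal Y=\{0\}$ if $q=0$), and for $\omega>\omega_{\min}$ $$\mathbf D_A(\omega):=V\,(V^*AA_\omega^{-1}AV)^{-1}\,V^*AA_\omega^{-1}.$$ (i) If $T$ is invertible, then there is a subset $\mathcal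 V$ of $\mathcal U:=(\omega_{\min},\infty)\times(\omega_{\min},\infty)$, closed in the relative topology of $\mathcal U$ and of $2$-dimensional Lebesgue measure zero, such that $\operatorname{Im}(\mathbf D_A(\omega)-\mathbf D_A(\mu))=\mathcal Y$ for all $(\omega,\mu)\in\mathcal U\setminus\mathcal V$. (ii) If $A$ is positive definite, then $\operatorname{Im}(\mathbf D_A(\omega)-\mathbf D_A(\mu))=\mathcal Y$ for all $\omega,\mu\ge 0$ with $\omega\ne\mu$. -/

import Mathlib

open scoped Matrix ComplexOrder

namespace ParamLS

noncomputable section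

/-- The image `{M x | x ∈ 𝕜ᵐ}` of a matrix `M`. -/
def img {𝕜 : Type*} [RCLike 𝕜] {n m : ℕ} (M : Matrix (Fin n) (Fin m) 𝕜) :
    Submodule 𝕜 (Fin n → 𝕜) :=
  LinearMap.range M.mulVecLin

/-- `ω_min = - λ_min(A)`, where `λ_min(A)` is the smallest (real) eigenvalue of the
Hermitian matrix `A`. -/
def omegaMin {𝕜 : Type*} [RCLike 𝕜] {n : ℕ} (A : Matrix (Fin n) (Fin n) 𝕜) : ℝ :=
  -sInf (spectrum ℝ A)

/-- The parameter domain `𝒰 = (ω_min, ∞) × (ω_min, ∞)`. -/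
def domainU {𝕜 : Type*} [RCLike 𝕜] {n : ℕ} (A : Matrix (Fin n) (Fin n) 𝕜) : Set (ℝ × ℝ) :=
  Set.Ioi (omegaMin A) ×ˢ Set.Ioi (omegaMin A)

/-- `A_ω = A + ω I`. -/
def shift {𝕜 : Type*} [RCLike 𝕜] {n : ℕ} (A : Matrix (Fin n) (Fin n) 𝕜) (ω : ℝ) :
    Matrix (Fin n) (Fin n) 𝕜 :=
  A + (ω : 𝕜) • (1 : Matrix (Fin n) (Fin n) 𝕜)

/-- `D_A(ω) = V (V* A A_ω⁻¹ A V)⁻¹ V* A A_ω⁻¹`. -/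
def DA {𝕜 : Type*} [RCLike 𝕜] {n p : ℕ} (A : Matrix (Fin n) (Fin n) 𝕜)
    (V : Matrix (Fin n) (Fin p) 𝕜) (ω : ℝ) : Matrix (Fin n) (Fin n) 𝕜 :=
  V * (Vᴴ * A * (shift A ω)⁻¹ * A * V)⁻¹ * (Vᴴ * A * (shift A ω)⁻¹)

/-- `T = V* A V`. -/
def blockT {𝕜 : Type*} [RCLike 𝕜] {n p : ℕ} (A : Matrix (Fin n) (Fin n) 𝕜)
    (V : Matrix (Fin n) (Fin p) 𝕜) : Matrix (Fin p) (Fin p) 𝕜 :=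
  Vᴴ * A * V

/-- `B = V'* A V`. -/
def blockB {𝕜 : Type*} [RCLike 𝕜] {n p q : ℕ} (A : Matrix (Fin n) (Fin n) 𝕜)
    (V : Matrix (Fin n) (Fin p) 𝕜) (V' : Matrix (Fin n) (Fin q) 𝕜) :
    Matrix (Fin q) (Fin p) 𝕜 :=
  V'ᴴ * A * V

/-- `H`, the matrix `T` stacked on top of `B`. -/
def blockH {𝕜 : Type*} [RCLike 𝕜] {n p q : ℕ} (A : Matrix (Fin n) (Fin n) 𝕜)
    (V : Matrix (Fin n) (Fin p) 𝕜) (V' : Matrix (Fin n) (Fin q) 𝕜) :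
    Matrix (Fin p ⊕ Fin q) (Fin p) 𝕜 :=
  Matrix.fromRows (blockT A V) (blockB A V V')

/-- The subspace `𝒴 = Im (V (H* H)⁻¹ B*)`; it is `{0}` when `q = 0`. -/
def spaceY {𝕜 : Type*} [RCLike 𝕜] {n p q : ℕ} (A : Matrix (Fin n) (Fin n) 𝕜)
    (V : Matrix (Fin n) (Fin p) 𝕜) (V' : Matrix (Fin n) (Fin q) 𝕜) :
    Submodule 𝕜 (Fin n → 𝕜) :=
  img (V * ((blockH A V V')ᴴ * blockH A V V')⁻¹ * (blockB A V V')ᴴ)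

end

end ParamLS

namespace ParamLS

noncomputable section

variable {𝕜 : Type*} [RCLike 𝕜] {n p q : ℕ}

/-! Write `D_A(ω) = V X_ω`, `C = V* A A_ω⁻¹ A V` and `N = H*H = V* A² V`. The map `X_ω` is a left
inverse of `A V` and kills `A_ω y` whenever `V* A y = 0`. Since `A_ω = A_μ + (ω - μ) I`, for such
`y` one gets `(X_ω - X_μ) A_ω y = (μ - ω) X_μ y`, while the difference vanishes on `Im (A V)`. As
`𝔽ⁿ = Im (A V) ⊕ A_ω ker (V* A)`, the image of `X_ω - X_μ` for `ω ≠ μ` is `X_μ (ker (V* A))`. This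
space equals `Im (N⁻¹ B*)`: `exists_gram_mul_coeffX_mul_eq` gives one inclusion,
`exists_coeffX_mul_eq` the other. Only `ω = μ` is exceptional, so both claims follow from
`img_DA_sub_DA`. -/

lemma img_mul_le {k l m : ℕ} (M : Matrix (Fin k) (Fin l) 𝕜) (G : Matrix (Fin l) (Fin m) 𝕜) :
    img (M * G) ≤ img M := by
  rintro _ ⟨x, rfl⟩
  exact ⟨G.mulVec x, by simp [Matrix.mulVec_mulVec]⟩

/-! ### Positivity of the shifts -/

/-- `A + ω I` is positive definite for `ω > ω_min`. -/
lemma posDef_shift_of_omegaMin_lt {A : Matrix (Fin n) (Fin n) 𝕜} (hA : A.IsHermitian) {ω : ℝ}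
    (hω : omegaMin A < ω) : (shift A ω).PosDef := by
  have hsh : shift A ω = algebraMap ℝ (Matrix (Fin n) (Fin n) 𝕜) ω + A := by
    rw [shift, add_comm, Algebra.algebraMap_eq_smul_one]
    congr 1
    ext i j
    simp [RCLike.real_smul_eq_coe_mul]
  have hH : (shift A ω).IsHermitian := by
    rw [shift]
    refine hA.add ?_
    simp [Matrix.IsHermitian, Matrix.conjTranspose_smul]
  rw [hH.posDef_iff_eigenvalues_pos]
  intro i
  have hi : hH.eigenvalues i ∈ spectrum ℝ (shift A ω) := by
    rw [hH.spectrum_real_eq_range_eigenvalues]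
    exact ⟨i, rfl⟩
  generalize hH.eigenvalues i = e at hi ⊢
  rw [hsh, ← spectrum.singleton_add_eq, Set.singleton_add] at hi
  obtain ⟨s, hs, hsi⟩ := hi
  have hbdd : BddBelow (spectrum ℝ A) := by
    rw [hA.spectrum_real_eq_range_eigenvalues]
    exact (Set.finite_range _).bddBelow
  have := csInf_le hbdd hs
  rw [omegaMin] at hω
  simp only at hsi
  linarith

lemma posDef_shift_of_nonneg {A : Matrix (Fin n) (Fin n) 𝕜} (hA : A.PosDef) {ω : ℝ}
    (hω : 0 ≤ ω) : (shift A ω).PosDef :=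
  hA.add_posSemidef (Matrix.PosSemidef.one.smul (by exact_mod_cast hω))

/-! ### Block decomposition of `A V` -/

lemma mul_eq_add_of_range {A : Matrix (Fin n) (Fin n) 𝕜} {S : Submodule 𝕜 (Fin n → 𝕜)}
    {V : Matrix (Fin n) (Fin p) 𝕜} {V' : Matrix (Fin n) (Fin q) 𝕜}
    (hVV' : (Matrix.fromCols V V')ᴴ * Matrix.fromCols V V' = 1)
    (hS : img V = S)
    (hSAS : LinearMap.range (Matrix.fromCols V V').mulVecLin = S ⊔ S.map A.mulVecLin) :
    A * V = V * blockT A V + V' * blockB A V V' := by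
  have hWH : Matrix.fromCols V V' * ((Matrix.fromCols V V')ᴴ * (A * V)) =
      V * blockT A V + V' * blockB A V V' := by
    rw [Matrix.conjTranspose_fromCols_eq_fromRows_conjTranspose, Matrix.fromRows_mul,
      Matrix.fromCols_mul_fromRows, blockT, blockB, Matrix.mul_assoc Vᴴ, Matrix.mul_assoc V'ᴴ]
  rw [← hWH]
  refine Matrix.ext_of_mulVec_single fun i => ?_
  have hmem : (A * V).mulVec (Pi.single i 1) ∈
      LinearMap.range (Matrix.fromCols V V').mulVecLin := by
    rw [hSAS, ← hS, ← Matrix.mulVec_mulVec]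
    exact Submodule.mem_sup_right ⟨_, ⟨_, rfl⟩, rfl⟩
  obtain ⟨x, hx⟩ := hmem
  rw [Matrix.mulVecLin_apply] at hx
  rw [← Matrix.mulVec_mulVec _ (Matrix.fromCols V V'), ← Matrix.mulVec_mulVec _ _ (A * V), ← hx,
    Matrix.mulVec_mulVec x, hVV', Matrix.one_mulVec]

lemma blocks_of_fromCols_orthonormal {V : Matrix (Fin n) (Fin p) 𝕜} {V' : Matrix (Fin n) (Fin q) 𝕜}
    (hVV' : (Matrix.fromCols V V')ᴴ * Matrix.fromCols V V' = 1) :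
    Vᴴ * V = 1 ∧ Vᴴ * V' = 0 ∧ V'ᴴ * V = 0 ∧ V'ᴴ * V' = 1 := by
  rw [Matrix.conjTranspose_fromCols_eq_fromRows_conjTranspose,
    Matrix.fromRows_mul_fromCols, ← Matrix.fromBlocks_one, Matrix.fromBlocks_inj] at hVV'
  exact hVV'

lemma blockH_gram {A : Matrix (Fin n) (Fin n) 𝕜} (hA : A.IsHermitian)
    {V : Matrix (Fin n) (Fin p) 𝕜} {V' : Matrix (Fin n) (Fin q) 𝕜}
    (hVV' : (Matrix.fromCols V V')ᴴ * Matrix.fromCols V V' = 1)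
    (hAV : A * V = V * blockT A V + V' * blockB A V V') :
    (blockH A V V')ᴴ * blockH A V V' = Vᴴ * A * A * V := by
  have h1 : A * V = Matrix.fromCols V V' * blockH A V V' := by
    rw [blockH, Matrix.fromCols_mul_fromRows, ← hAV]
  have h2 : Vᴴ * A * A * V = (A * V)ᴴ * (A * V) := by
    rw [Matrix.conjTranspose_mul, hA.eq, Matrix.mul_assoc (Vᴴ * A)]
  rw [h2, h1, Matrix.conjTranspose_mul, Matrix.mul_assoc, ← Matrix.mul_assoc _ _ (blockH A V V'),
    hVV', Matrix.one_mul]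

/-! ### The coefficient map `X_ω` -/

/-- The matrix `V* A A_ω⁻¹ A V`. -/
def innerC (A : Matrix (Fin n) (Fin n) 𝕜) (V : Matrix (Fin n) (Fin p) 𝕜) (ω : ℝ) :
    Matrix (Fin p) (Fin p) 𝕜 :=
  Vᴴ * A * (shift A ω)⁻¹ * A * V

/-- The coefficient matrix `(V* A A_ω⁻¹ A V)⁻¹ V* A A_ω⁻¹` of `D_A(ω)` with respect to `V`. -/
def coeffX (A : Matrix (Fin n) (Fin n) 𝕜) (V : Matrix (Fin n) (Fin p) 𝕜) (ω : ℝ) :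
    Matrix (Fin p) (Fin n) 𝕜 :=
  (innerC A V ω)⁻¹ * (Vᴴ * A * (shift A ω)⁻¹)

lemma DA_eq_mul_coeffX (A : Matrix (Fin n) (Fin n) 𝕜) (V : Matrix (Fin n) (Fin p) 𝕜) (ω : ℝ) :
    DA A V ω = V * coeffX A V ω := by
  rw [DA, coeffX, innerC, Matrix.mul_assoc]

lemma mul_mulVec_injective {A : Matrix (Fin n) (Fin n) 𝕜} (hAinv : IsUnit A)
    {V : Matrix (Fin n) (Fin p) 𝕜} (hV : Vᴴ * V = 1) :
    Function.Injective (A * V).mulVec := by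
  have hdet := (Matrix.isUnit_iff_isUnit_det A).1 hAinv
  refine Function.LeftInverse.injective (g := (Vᴴ * A⁻¹).mulVec) fun x => ?_
  rw [Matrix.mulVec_mulVec, Matrix.mul_assoc, Matrix.nonsing_inv_mul_cancel_left _ _ hdet, hV,
    Matrix.one_mulVec]

lemma isUnit_det_innerC {A : Matrix (Fin n) (Fin n) 𝕜} (hA : A.IsHermitian) (hAinv : IsUnit A)
    {V : Matrix (Fin n) (Fin p) 𝕜} (hV : Vᴴ * V = 1) {ω : ℝ} (hω : (shift A ω).PosDef) :
    IsUnit (innerC A V ω).det := by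
  have h := hω.inv.conjTranspose_mul_mul_same (mul_mulVec_injective hAinv hV)
  rw [Matrix.conjTranspose_mul, hA.eq] at h
  rw [innerC, Matrix.mul_assoc _ A V]
  exact (Matrix.isUnit_iff_isUnit_det _).1 h.isUnit

lemma isUnit_det_gram {A : Matrix (Fin n) (Fin n) 𝕜} (hA : A.IsHermitian) (hAinv : IsUnit A)
    {V : Matrix (Fin n) (Fin p) 𝕜} (hV : Vᴴ * V = 1) :
    IsUnit (Vᴴ * A * A * V).det := by
  have h := (Matrix.PosDef.one (n := Fin n) (R := 𝕜)).conjTranspose_mul_mul_same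
    (mul_mulVec_injective hAinv hV)
  rw [Matrix.conjTranspose_mul, hA.eq, Matrix.mul_one] at h
  rw [Matrix.mul_assoc _ A V]
  exact (Matrix.isUnit_iff_isUnit_det _).1 h.isUnit

lemma isUnit_det_shift {A : Matrix (Fin n) (Fin n) 𝕜} {ω : ℝ} (hω : (shift A ω).PosDef) :
    IsUnit (shift A ω).det :=
  (Matrix.isUnit_iff_isUnit_det _).1 hω.isUnit

lemma shift_mul_comm (A : Matrix (Fin n) (Fin n) 𝕜) (ω : ℝ) :
    shift A ω * A = A * shift A ω := by
  simp [shift, Matrix.add_mul, Matrix.mul_add]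

lemma shift_eq_shift_add (A : Matrix (Fin n) (Fin n) 𝕜) (ω μ : ℝ) :
    shift A ω = shift A μ + ((ω : 𝕜) - μ) • (1 : Matrix (Fin n) (Fin n) 𝕜) := by
  rw [shift, shift, sub_smul]
  abel

lemma conjTranspose_mul_shift {A : Matrix (Fin n) (Fin n) 𝕜} (hA : A.IsHermitian)
    {V : Matrix (Fin n) (Fin p) 𝕜} {V' : Matrix (Fin n) (Fin q) 𝕜}
    (hAV : A * V = V * blockT A V + V' * blockB A V V') (ω : ℝ) :
    Vᴴ * shift A ω = (blockT A V + (ω : 𝕜) • 1) * Vᴴ + (blockB A V V')ᴴ * V'ᴴ := by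
  have hT : (blockT A V)ᴴ = blockT A V := by
    simp [blockT, Matrix.conjTranspose_mul, hA.eq, Matrix.mul_assoc]
  have h := congrArg Matrix.conjTranspose hAV
  rw [Matrix.conjTranspose_mul, hA.eq, Matrix.conjTranspose_add, Matrix.conjTranspose_mul,
    Matrix.conjTranspose_mul, hT] at h
  rw [shift, Matrix.mul_add, h, Matrix.add_mul]
  simp only [Matrix.mul_smul, Matrix.smul_mul, Matrix.mul_one, Matrix.one_mul]
  abel

/-- Multiply `conjTranspose_mul_shift` on the right by `A A_ω⁻¹ A V`; `A_ω` commutes with `A`, so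
the left side collapses to `N`. -/
lemma blockT_shift_mul_innerC {A : Matrix (Fin n) (Fin n) 𝕜} (hA : A.IsHermitian)
    {V : Matrix (Fin n) (Fin p) 𝕜} {V' : Matrix (Fin n) (Fin q) 𝕜}
    (hAV : A * V = V * blockT A V + V' * blockB A V V') {ω : ℝ} (hω : (shift A ω).PosDef) :
    (blockT A V + (ω : 𝕜) • 1) * innerC A V ω =
      Vᴴ * A * A * V - (blockB A V V')ᴴ * (V'ᴴ * A * (shift A ω)⁻¹ * A * V) := by
  have h := congrArg (· * (A * (shift A ω)⁻¹ * A * V)) (conjTranspose_mul_shift hA hAV ω)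
  have h1 : Vᴴ * shift A ω * (A * (shift A ω)⁻¹ * A * V) = Vᴴ * A * A * V := by
    have : shift A ω * (A * (shift A ω)⁻¹ * A * V) = A * A * V := by
      simp only [← Matrix.mul_assoc]
      rw [shift_mul_comm, Matrix.mul_nonsing_inv_cancel_right _ _ (isUnit_det_shift hω)]
    rw [Matrix.mul_assoc, this]
    simp only [Matrix.mul_assoc]
  simp only [h1, Matrix.add_mul] at h
  rw [h, innerC]
  simp only [Matrix.mul_assoc, Matrix.add_mul]
  abel

lemma innerC_mul_coeffX {A : Matrix (Fin n) (Fin n) 𝕜} {V : Matrix (Fin n) (Fin p) 𝕜} {ω : ℝ}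
    (hC : IsUnit (innerC A V ω).det) :
    innerC A V ω * coeffX A V ω = Vᴴ * A * (shift A ω)⁻¹ := by
  rw [coeffX, Matrix.mul_nonsing_inv_cancel_left _ _ hC]

lemma coeffX_mul_mul {A : Matrix (Fin n) (Fin n) 𝕜} {V : Matrix (Fin n) (Fin p) 𝕜} {ω : ℝ}
    (hC : IsUnit (innerC A V ω).det) : coeffX A V ω * (A * V) = 1 := by
  rw [coeffX, Matrix.mul_assoc, ← Matrix.mul_assoc (Vᴴ * A * (shift A ω)⁻¹)]
  exact Matrix.nonsing_inv_mul _ hC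

lemma coeffX_mul_shift_mul {m : ℕ} {A : Matrix (Fin n) (Fin n) 𝕜} {V : Matrix (Fin n) (Fin p) 𝕜}
    {ω : ℝ} (hω : (shift A ω).PosDef) {Y : Matrix (Fin n) (Fin m) 𝕜} (hY : Vᴴ * A * Y = 0) :
    coeffX A V ω * (shift A ω * Y) = 0 := by
  rw [coeffX, Matrix.mul_assoc, Matrix.mul_assoc (Vᴴ * A),
    Matrix.nonsing_inv_mul_cancel_left _ _ (isUnit_det_shift hω), hY, Matrix.mul_zero]

lemma coeffX_sub_mul_shift_mul {m : ℕ} {A : Matrix (Fin n) (Fin n) 𝕜}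
    {V : Matrix (Fin n) (Fin p) 𝕜} {ω μ : ℝ} (hω : (shift A ω).PosDef) (hμ : (shift A μ).PosDef)
    {Y : Matrix (Fin n) (Fin m) 𝕜} (hY : Vᴴ * A * Y = 0) :
    (coeffX A V ω - coeffX A V μ) * (shift A ω * Y) =
      ((μ : 𝕜) - ω) • (coeffX A V μ * Y) := by
  rw [Matrix.sub_mul, coeffX_mul_shift_mul hω hY, shift_eq_shift_add A ω μ, Matrix.add_mul,
    Matrix.mul_add, coeffX_mul_shift_mul hμ hY, Matrix.smul_mul, Matrix.one_mul, Matrix.mul_smul,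
    zero_add, zero_sub, ← neg_smul, neg_sub]

/-- Put `x = X_ω Y` and `u = A_ω⁻¹ A Y`, so that `C x = V* u`. Then `0 = V* A_ω u = (T + ω) C x + B*
V'* u`, and the formula for `(T + ω) C` turns this into `N x = B* (E x - V'* u)` with `E = V'* A
A_ω⁻¹ A V`. -/
lemma exists_gram_mul_coeffX_mul_eq {m : ℕ} {A : Matrix (Fin n) (Fin n) 𝕜} (hA : A.IsHermitian)
    {V : Matrix (Fin n) (Fin p) 𝕜} {V' : Matrix (Fin n) (Fin q) 𝕜}
    (hAV : A * V = V * blockT A V + V' * blockB A V V') {ω : ℝ} (hω : (shift A ω).PosDef)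
    (hC : IsUnit (innerC A V ω).det) {Y : Matrix (Fin n) (Fin m) 𝕜} (hY : Vᴴ * A * Y = 0) :
    ∃ G : Matrix (Fin q) (Fin m) 𝕜,
      Vᴴ * A * A * V * (coeffX A V ω * Y) = (blockB A V V')ᴴ * G := by
  have hdet := isUnit_det_shift hω
  have hcomm : A * (shift A ω)⁻¹ = (shift A ω)⁻¹ * A := by
    rw [← Matrix.nonsing_inv_mul_cancel_left _ (A * (shift A ω)⁻¹) hdet,
      ← Matrix.mul_assoc (shift A ω), shift_mul_comm, Matrix.mul_nonsing_inv_cancel_right _ _ hdet]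
  have hu := congrArg (· * ((shift A ω)⁻¹ * (A * Y))) (conjTranspose_mul_shift hA hAV ω)
  simp only [Matrix.add_mul (_ * _)] at hu
  rw [Matrix.mul_assoc, Matrix.mul_nonsing_inv_cancel_left _ _ hdet, ← Matrix.mul_assoc, hY,
    Matrix.mul_assoc _ Vᴴ, Matrix.mul_assoc _ V'ᴴ] at hu
  have hx : innerC A V ω * (coeffX A V ω * Y) = Vᴴ * ((shift A ω)⁻¹ * (A * Y)) := by
    rw [← Matrix.mul_assoc, innerC_mul_coeffX hC, Matrix.mul_assoc Vᴴ, hcomm]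
    simp only [Matrix.mul_assoc]
  have hN := congrArg (· * (coeffX A V ω * Y)) (blockT_shift_mul_innerC hA hAV hω)
  simp only [Matrix.sub_mul] at hN
  rw [Matrix.mul_assoc, hx] at hN
  refine ⟨V'ᴴ * A * (shift A ω)⁻¹ * A * V * (coeffX A V ω * Y)
    - V'ᴴ * ((shift A ω)⁻¹ * (A * Y)), ?_⟩
  rw [Matrix.mul_sub, sub_eq_add_neg, ← eq_neg_of_add_eq_zero_left hu.symm, hN]
  simp only [Matrix.mul_assoc]
  abel

/-- Converse of the previous computation: prescribe the blocks `V* u` and `V'* u`, then solve for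
`Y`. -/
lemma exists_coeffX_mul_eq {A : Matrix (Fin n) (Fin n) 𝕜} (hA : A.IsHermitian) (hAinv : IsUnit A)
    {V : Matrix (Fin n) (Fin p) 𝕜} {V' : Matrix (Fin n) (Fin q) 𝕜}
    (hVV' : (Matrix.fromCols V V')ᴴ * Matrix.fromCols V V' = 1)
    (hAV : A * V = V * blockT A V + V' * blockB A V V') {ω : ℝ} (hω : (shift A ω).PosDef) :
    ∃ Y : Matrix (Fin n) (Fin q) 𝕜, Vᴴ * A * Y = 0 ∧
      coeffX A V ω * Y = (Vᴴ * A * A * V)⁻¹ * (blockB A V V')ᴴ := by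
  obtain ⟨h11, h12, h21, h22⟩ := blocks_of_fromCols_orthonormal hVV'
  have hdet := isUnit_det_shift hω
  have hdetA := (Matrix.isUnit_iff_isUnit_det A).1 hAinv
  have hC := isUnit_det_innerC hA hAinv h11 hω
  have hNdet := isUnit_det_gram hA hAinv h11
  set X := (Vᴴ * A * A * V)⁻¹ * (blockB A V V')ᴴ with hX
  set E := V'ᴴ * A * (shift A ω)⁻¹ * A * V with hE
  -- Forced by `V* U = C X` and `E X - V'* U = 1`; then `A_ω⁻¹ A Y = U` gives `Y = A⁻¹ A_ω U`.
  set U := V * (innerC A V ω * X) + V' * (E * X - 1) with hU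
  have hVU : Vᴴ * U = innerC A V ω * X := by
    rw [hU, Matrix.mul_add, ← Matrix.mul_assoc, ← Matrix.mul_assoc Vᴴ V', h11, h12]
    simp
  have hV'U : V'ᴴ * U = E * X - 1 := by
    rw [hU, Matrix.mul_add, ← Matrix.mul_assoc, ← Matrix.mul_assoc V'ᴴ V', h21, h22]
    simp
  have hNX : Vᴴ * A * A * V * X = (blockB A V V')ᴴ := by
    rw [hX, Matrix.mul_nonsing_inv_cancel_left _ _ hNdet]
  refine ⟨A⁻¹ * (shift A ω * U), ?_, ?_⟩
  · rw [Matrix.mul_assoc, Matrix.mul_nonsing_inv_cancel_left _ _ hdetA, ← Matrix.mul_assoc,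
      conjTranspose_mul_shift hA hAV ω, Matrix.add_mul, Matrix.mul_assoc _ Vᴴ,
      Matrix.mul_assoc _ V'ᴴ, hVU, hV'U, ← Matrix.mul_assoc, blockT_shift_mul_innerC hA hAV hω,
      Matrix.sub_mul, hNX, ← hE, Matrix.mul_sub, Matrix.mul_assoc, Matrix.mul_one]
    abel
  · have hcancel : A * ((shift A ω)⁻¹ * (A⁻¹ * (shift A ω * U))) = U := by
      have : shift A ω * U = A * (shift A ω * (A⁻¹ * U)) := by
        rw [← Matrix.mul_assoc A, ← shift_mul_comm, Matrix.mul_assoc,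
          Matrix.mul_nonsing_inv_cancel_left _ _ hdetA]
      rw [this, Matrix.nonsing_inv_mul_cancel_left _ _ hdetA,
        Matrix.nonsing_inv_mul_cancel_left _ _ hdet, Matrix.mul_nonsing_inv_cancel_left _ _ hdetA]
    rw [coeffX, Matrix.mul_assoc, Matrix.mul_assoc, Matrix.mul_assoc Vᴴ, hcancel, hVU,
      Matrix.nonsing_inv_mul_cancel_left _ _ hC]

/-- The image of `D_A(ω) - D_A(μ)` is `𝒴` for distinct `ω`, `μ` with positive definite shifts. -/
theorem img_DA_sub_DA {A : Matrix (Fin n) (Fin n) 𝕜} (hA : A.IsHermitian) (hAinv : IsUnit A)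
    {V : Matrix (Fin n) (Fin p) 𝕜} {V' : Matrix (Fin n) (Fin q) 𝕜}
    (hVV' : (Matrix.fromCols V V')ᴴ * Matrix.fromCols V V' = 1)
    (hAV : A * V = V * blockT A V + V' * blockB A V V') {ω μ : ℝ}
    (hω : (shift A ω).PosDef) (hμ : (shift A μ).PosDef) (hne : ω ≠ μ) :
    img (DA A V ω - DA A V μ) = spaceY A V V' := by
  obtain ⟨h11, -, -, -⟩ := blocks_of_fromCols_orthonormal hVV'
  have hCω := isUnit_det_innerC hA hAinv h11 hω
  have hCμ := isUnit_det_innerC hA hAinv h11 hμ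
  have hne' : ((μ : 𝕜) - ω) ≠ 0 := sub_ne_zero.2 fun h => hne (by exact_mod_cast h.symm)
  rw [spaceY, blockH_gram hA hVV' hAV, DA_eq_mul_coeffX, DA_eq_mul_coeffX, ← Matrix.mul_sub]
  apply le_antisymm
  -- `A_ω Y` is the projection onto `ker X_ω` along `Im (A V)`, so multiplying `X_ω - X_μ` by it
  -- changes nothing.
  · set Y := (shift A ω)⁻¹ * (1 - A * V * coeffX A V ω) with hYdef
    have hY : Vᴴ * A * Y = 0 := by
      rw [hYdef, ← Matrix.mul_assoc, Matrix.mul_sub, Matrix.mul_one, ← Matrix.mul_assoc,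
        ← Matrix.mul_assoc, ← innerC, innerC_mul_coeffX hCω, sub_self]
    have hZ := coeffX_sub_mul_shift_mul hω hμ hY
    rw [hYdef, Matrix.mul_nonsing_inv_cancel_left _ _ (isUnit_det_shift hω), ← hYdef,
      Matrix.mul_sub, Matrix.mul_one, ← Matrix.mul_assoc, Matrix.sub_mul _ _ (A * V),
      coeffX_mul_mul hCω, coeffX_mul_mul hCμ, sub_self, Matrix.zero_mul, sub_zero] at hZ
    obtain ⟨G, hG⟩ := exists_gram_mul_coeffX_mul_eq hA hAV hμ hCμ hY
    have hG' : coeffX A V μ * Y = (Vᴴ * A * A * V)⁻¹ * ((blockB A V V')ᴴ * G) := by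
      rw [← hG, Matrix.nonsing_inv_mul_cancel_left _ _ (isUnit_det_gram hA hAinv h11)]
    have : V * (coeffX A V ω - coeffX A V μ) =
        V * (Vᴴ * A * A * V)⁻¹ * (blockB A V V')ᴴ * (((μ : 𝕜) - ω) • G) := by
      rw [hZ, hG']
      simp only [Matrix.mul_smul, Matrix.mul_assoc]
    rw [this]
    exact img_mul_le _ _
  · obtain ⟨Y, hY, hXY⟩ := exists_coeffX_mul_eq hA hAinv hVV' hAV hμ
    have : V * (Vᴴ * A * A * V)⁻¹ * (blockB A V V')ᴴ =
        V * (coeffX A V ω - coeffX A V μ) * (((μ : 𝕜) - ω)⁻¹ • (shift A ω * Y)) := by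
      rw [Matrix.mul_smul, Matrix.mul_assoc V (_ - _), coeffX_sub_mul_shift_mul hω hμ hY, hXY,
        Matrix.mul_smul, smul_smul, inv_mul_cancel₀ hne', one_smul, Matrix.mul_assoc]
    rw [this]
    exact img_mul_le _ _

lemma volume_setOf_fst_eq_snd :
    MeasureTheory.volume {x : ℝ × ℝ | x.1 = x.2} = 0 := by
  have hm : MeasurableSet {x : ℝ × ℝ | x.1 = x.2} :=
    (isClosed_eq continuous_fst continuous_snd).measurableSet
  rw [MeasureTheory.Measure.volume_eq_prod, MeasureTheory.Measure.measure_prod_null hm]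
  refine Filter.Eventually.of_forall fun x => ?_
  have : Prod.mk x ⁻¹' {y : ℝ × ℝ | y.1 = y.2} = {x} := by
    ext y
    simp [eq_comm]
  simp [this]

end

end ParamLS

theorem mainTheorem5 {𝕜 : Type*} [RCLike 𝕜] {n p q : ℕ} (hp : 1 ≤ p)
    (A : Matrix (Fin n) (Fin n) 𝕜) (hA : A.IsHermitian) (hAinv : IsUnit A)
    (S : Submodule 𝕜 (Fin n → 𝕜))
    (V : Matrix (Fin n) (Fin p) 𝕜) (V' : Matrix (Fin n) (Fin q) 𝕜)
    (hVV' : (Matrix.fromCols V V')ᴴ * Matrix.fromCols V V' = 1)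
    (hS : ParamLS.img V = S)
    (hSAS : LinearMap.range (Matrix.fromCols V V').mulVecLin = S ⊔ S.map A.mulVecLin) :
    (IsUnit (ParamLS.blockT A V) →
      ∃ 𝒱 : Set (ℝ × ℝ), 𝒱 ⊆ ParamLS.domainU A ∧
        IsClosed ((↑) ⁻¹' 𝒱 : Set (ParamLS.domainU A)) ∧
        MeasureTheory.volume 𝒱 = 0 ∧
        ∀ ω μ : ℝ, (ω, μ) ∈ ParamLS.domainU A \ 𝒱 →
          ParamLS.img (ParamLS.DA A V ω - ParamLS.DA A V μ) = ParamLS.spaceY A V V') ∧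
    (A.PosDef →
      ∀ ω μ : ℝ, 0 ≤ ω → 0 ≤ μ → ω ≠ μ →
        ParamLS.img (ParamLS.DA A V ω - ParamLS.DA A V μ) = ParamLS.spaceY A V V') := by
  have hAV := ParamLS.mul_eq_add_of_range hVV' hS hSAS
  -- The exceptional set is the diagonal of `𝒰`.
  refine ⟨fun _ => ⟨ParamLS.domainU A ∩ {x | x.1 = x.2}, Set.inter_subset_left, ?_, ?_, ?_⟩, ?_⟩
  · rw [Set.preimage_inter, Subtype.coe_preimage_self, Set.univ_inter]
    exact (isClosed_eq continuous_fst continuous_snd).preimage continuous_subtype_val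
  · exact MeasureTheory.measure_mono_null Set.inter_subset_right ParamLS.volume_setOf_fst_eq_snd
  · rintro ω μ ⟨hU, hV⟩
    exact ParamLS.img_DA_sub_DA hA hAinv hVV' hAV (ParamLS.posDef_shift_of_omegaMin_lt hA hU.1)
      (ParamLS.posDef_shift_of_omegaMin_lt hA hU.2) fun h => hV ⟨hU, h⟩
  · intro hpos ω μ hω hμ hne
    exact ParamLS.img_DA_sub_DA hA hAinv hVV' hAV (ParamLS.posDef_shift_of_nonneg hpos hω)
      (ParamLS.posDef_shift_of_nonneg hpos hμ) hne
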